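/- Let $K$ be a field, let $n>m\geq 2$ and $t\geq 1$ be integers, and let $S=K[x_1,\ldots,x_n]$ and $S'=K[x_1,\ldots,x_{n-1}]\subset S$. Let $$J=(x_1x_2\cdots x_m,\ x_2\cdots x_{m+1},\ \ldots,\ x_{n-m+1}\cdots x_n,\ x_{n-m+2}\cdots x_nx_1,\ \ldots,\ x_nx_1\cdots x_{m-1})\subset S$$ be the $m$-path ideal of the cycle graph on $n$ vertices, let $$I=(x_1\cdots x_m,\ x_2\cdots x_{m+1},\ \ldots,\ x_{n-m}\cdots x_{n-1})\subset S'$$ be the $m$-path ideal of the path graph on $n-1$ vertices, and let $J'=(J:x_n)\cap S'$. For a proper monomial ideal $L$ of a polynomial ring $R$ in finitely many variables over $K$, let $\operatorname{depth}(R/L)$ be the maximal length of an $R/L$-regular sequence contained in the ideal generated by the variables. A Stanley decomposition of $R/L$ is a decomposition $\mathcal D:\ R/L=\bigoplus_{i=1}^r u_iK[Z_i]$ as a direct sum of $K$-vector spaces, where each $u_i$ is a monomial, each $Z_i$ is a set of variables, and each $u_iK[Z_i]\subset R/L$ is a free $K[Z_i]$-module. The Stanley depth $\operatorname{sdepth}(R/L)$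 is the maximum, over all such $\mathcal D$, of $\min_i|Z_i|$. For $1\leq k\leq t$ put $$d_k=\operatorname{depth}\bigl(S'/I^{t+1-k}J'^{\,k-1}\bigr),\qquad s_k=\operatorname{sdepth}\bigl(S'/I^{t+1-k}J'^{\,k-1}\bigr).$$ Then for all $1\leq k\leq t$: 1. $d_k\geq \operatorname{depth}(S/(J^t:x_n^{k-1}))-1$. 2. If $\operatorname{depth}(S/(J^t:x_n^{k}))>\operatorname{depth}(S/(J^t:x_n^{k-1}))$, then $d_k=\operatorname{depth}(S/(J^t:x_n^{k-1}))$. 3. If $\operatorname{sdepth}(S/(J^t:x_n^{k}))>\operatorname{sdepth}(S/(J^t:x_n^{k-1}))$, then $s_k\leq \operatorname{sdepth}(S/(J^t:x_n^{k-1}))$. -/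

import Mathlib

open MvPolynomial

/-- The depth of `M` with respect to the ideal `I`: the supremum of the lengths of the `M`-regular
sequences with entries in `I`. For a nonzero finitely generated graded module `M` over a polynomial
ring over a field and `I` the ideal generated by the variables, this is the usual depth of `M`. -/
noncomputable def gradedDepth {R : Type*} [CommRing R] (I : Ideal R)
    (M : Type*) [AddCommGroup M] [Module R M] : ℕ∞ :=
  ⨆ (rs : List R) (_ : RingTheory.Sequence.IsRegular M rs ∧ ∀ r ∈ rs, r ∈ I), (rs.length : ℕ∞)

/-- `depth (S / L)` for an ideal `L` of the polynomial ring `S = K[x_i : i ∈ σ]`. -/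
noncomputable def quotDepth {σ K : Type*} [Field K] (L : Ideal (MvPolynomial σ K)) : ℕ∞ :=
  gradedDepth (idealOfVars σ K) (MvPolynomial σ K ⧸ L)

/-- The `K`-subspace `u K[Z]` of `S / L`, where `u` is the monomial with exponent vector `u` and
`Z` is a set of variables. -/
noncomputable def stanleySpace {σ K : Type*} [Field K] (L : Ideal (MvPolynomial σ K))
    (u : σ →₀ ℕ) (Z : Finset σ) : Submodule K (MvPolynomial σ K ⧸ L) :=
  ((Subalgebra.toSubmodule (supported K (Z : Set σ))).map
    (LinearMap.mulLeft K (monomial u (1 : K)))).map (Ideal.Quotient.mkₐ K L).toLinearMap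

/-- A Stanley decomposition of `S / L`: a finite family of monomials `u_i` and sets of variables
`Z_i` such that each `u_i K[Z_i] ⊆ S / L` is a free `K[Z_i]`-module (that is, `f ↦ u_i f` is
injective from `K[Z_i]` to `S / L`) and `S / L` is the direct sum of the `u_i K[Z_i]`. -/
structure StanleyDecomposition {σ K : Type*} [Field K] (L : Ideal (MvPolynomial σ K)) where
  r : ℕ
  u : Fin r → (σ →₀ ℕ)
  Z : Fin r → Finset σ
  free : ∀ i, ∀ f ∈ supported K (Z i : Set σ), monomial (u i) (1 : K) * f ∈ L → f = 0
  isInternal : DirectSum.IsInternal fun i => stanleySpace L (u i) (Z i)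

/-- The Stanley depth of a Stanley decomposition: the minimum of the `|Z_i|`. -/
noncomputable def StanleyDecomposition.sdepth {σ K : Type*} [Field K]
    {L : Ideal (MvPolynomial σ K)} (D : StanleyDecomposition L) : ℕ∞ :=
  ⨅ i, ((D.Z i).card : ℕ∞)

/-- The Stanley depth `sdepth (S / L)`. -/
noncomputable def quotSdepth {σ K : Type*} [Field K] (L : Ideal (MvPolynomial σ K)) : ℕ∞ :=
  ⨆ D : StanleyDecomposition L, D.sdepth

/-- The `m`-path ideal `I_{n,m} = (x_1 ⋯ x_m, x_2 ⋯ x_{m+1}, …, x_{n-m+1} ⋯ x_n)` of the path graph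
on `n` vertices; the variable `x_i` is `X ⟨i - 1, _⟩`. -/
noncomputable def pathIdeal (K : Type*) [Field K] (n m : ℕ) : Ideal (MvPolynomial (Fin n) K) :=
  Ideal.span {p | ∃ (i : ℕ) (h : i + m ≤ n), p = ∏ j : Fin m, X ⟨i + j, by omega⟩}

/-- The `m`-path ideal `J_{n,m}` of the cycle graph on `n` vertices: it is generated by the products
of `m` cyclically consecutive variables. -/
noncomputable def cyclePathIdeal (K : Type*) [Field K] (n m : ℕ) :
    Ideal (MvPolynomial (Fin n) K) :=
  Ideal.span {p | ∃ i : Fin n, p = ∏ j : Fin m, X ⟨(i + j) % n, Nat.mod_lt _ i.pos⟩}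

/-- The variable `x_n` of `S = K[x_1, …, x_n]`. -/
noncomputable def lastVar (K : Type*) [Field K] (n : ℕ) (hn : 0 < n) : MvPolynomial (Fin n) K :=
  X ⟨n - 1, Nat.sub_lt hn Nat.one_pos⟩

/-- The ideal `J' = (J_{n,m} : x_n) ∩ S'` of `S' = K[x_1, …, x_{n-1}] ⊆ S`. -/
noncomputable def contractedColon (K : Type*) [Field K] (n m : ℕ) (hn : 0 < n) :
    Ideal (MvPolynomial (Fin (n - 1)) K) :=
  ((cyclePathIdeal K n m).colon {lastVar K n hn}).comap
    (rename (Fin.castLE (Nat.sub_le n 1)) :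
      MvPolynomial (Fin (n - 1)) K →ₐ[K] MvPolynomial (Fin n) K)

/-- The ideal `I^{t+1-k} J'^{k-1}` of `S'`, where `I = I_{n-1,m}`; it is used for `1 ≤ k ≤ t`. -/
noncomputable def mixedIdeal (K : Type*) [Field K] (n m : ℕ) (hn : 0 < n) (t k : ℕ) :
    Ideal (MvPolynomial (Fin (n - 1)) K) :=
  pathIdeal K (n - 1) m ^ (t + 1 - k) * contractedColon K n m hn ^ (k - 1)

/-- The ideal `(J_{n,m}^t : x_n^k)` of `S`. -/
noncomputable def colonIdeal (K : Type*) [Field K] (n m : ℕ) (hn : 0 < n) (t k : ℕ) :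
    Ideal (MvPolynomial (Fin n) K) :=
  (cyclePathIdeal K n m ^ t).colon {lastVar K n hn ^ k}

/-! Write `S = S'[X]` with `X = x_n`. Since `m < n`, a generator of `J` contains `x_n` at most once,
so `J = I + X J'` with `I ⊆ J'`. Hence `J ^ t` is graded by powers of `X`, with degree-`a`
coefficients forming `I ^ (t - a) * J' ^ a` for `a ≤ t` and `J' ^ t` beyond
(`mem_linearExtension_pow_iff`). Put `L = (J ^ t : X ^ (k - 1))`. Then `(L : X) = (J ^ t : X ^ k)`,
and `L ∩ S'` is the degree-zero part `I ^ (t + 1 - k) * J' ^ (k - 1)`, so there is an exact sequence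
`0 → S/(L : X) → S/L → S'/(L ∩ S') → 0`.

Claim 2 is the depth lemma for this sequence (`DepthGE.of_colon_of_sup`, `DepthGE.sup_of_colon`).
Claim 3 holds because the sequence splits over `K` compatibly with monomials: Stanley decompositions
of the outer terms glue to one of `S/L` (`min_quotSdepth_le`).

Claim 1 does not follow from the sequence alone. If `S/L` has depth at least `p + 1`, a weakly
regular sequence of length `p` can be chosen among polynomials free of `X` (`DepthGE.C_image`); it
stays weakly regular on `S'/(L ∩ S')`, a direct summand of `S/L` over `S'` (`DepthGE.comap_C`). -/

/-! ### Depth through weakly regular sequences, and the depth lemma -/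

section DepthOfIdeals

variable {R : Type*} [CommRing R]

/-- `f` is a nonzerodivisor modulo `L`. -/
def IsRegularMod (L : Ideal R) (f : R) : Prop := ∀ z, f * z ∈ L → z ∈ L

/-- There is a weakly `R / L`-regular sequence of length `p` with entries in `G`. -/
def DepthGE (G : Set R) : ℕ → Ideal R → Prop
  | 0, _ => True
  | p + 1, L => ∃ f ∈ G, IsRegularMod L f ∧ DepthGE G p (L ⊔ Ideal.span {f})

/-- No nonzero element of `R / L` is annihilated by `G`. -/
def SocleFree (G : Set R) (L : Ideal R) : Prop := ∀ z, (∀ g ∈ G, g * z ∈ L) → z ∈ L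

/-- `G` satisfies prime avoidance. -/
def AvoidsPrimes (G : Set R) : Prop :=
  ∀ s : Set (Ideal R), s.Finite → (∀ P ∈ s, P.IsPrime) → G ⊆ ⋃ P ∈ s, (P : Set R) →
    ∃ P ∈ s, G ⊆ P

theorem Ideal.avoidsPrimes (I : Ideal R) : AvoidsPrimes (I : Set R) := by
  intro s hs hp h
  exact (I.subset_union_prime_finite hs (f := id) 0 0 fun P hP _ _ => hp P hP).1 h

/-- Primes pull back to primes along `φ`. The case of interest is `C '' I`, which need not be an
ideal of `A[X]`. -/
theorem AvoidsPrimes.image_comap {A : Type*} [CommRing A] {G : Set A} (hG : AvoidsPrimes G)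
    (φ : A →+* R) : AvoidsPrimes (φ '' G) := by
  intro s hs hp h
  have := hG (Ideal.comap φ '' s) (hs.image _)
    (by rintro _ ⟨P, hP, rfl⟩; have := hp P hP; exact P.comap_isPrime φ) (by
      intro g hg
      obtain ⟨P, hP, hgP⟩ := Set.mem_iUnion₂.1 (h ⟨g, hg, rfl⟩)
      exact Set.mem_iUnion₂.2 ⟨_, ⟨P, hP, rfl⟩, hgP⟩)
  obtain ⟨_, ⟨P, hP, rfl⟩, h'⟩ := this
  exact ⟨P, hP, by rintro _ ⟨g, hg, rfl⟩; exact h' hg⟩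

theorem IsRegularMod.socleFree {G : Set R} {L : Ideal R} {f : R} (hf : f ∈ G)
    (h : IsRegularMod L f) : SocleFree G L := fun z hz => h z (hz f hf)

theorem DepthGE.socleFree {G : Set R} {L : Ideal R} {p : ℕ} (h : DepthGE G (p + 1) L) :
    SocleFree G L := by
  obtain ⟨f, hf, hr, -⟩ := h
  exact hr.socleFree hf

theorem DepthGE.of_succ {G : Set R} {p : ℕ} : ∀ {L : Ideal R}, DepthGE G (p + 1) L →
    DepthGE G p L := by
  induction p with
  | zero => intros; trivial
  | succ p ih =>
    rintro L ⟨f, hf, hr, h⟩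
    exact ⟨f, hf, hr, ih h⟩

theorem DepthGE.mono {G : Set R} {p q : ℕ} (hpq : p ≤ q) {L : Ideal R} (h : DepthGE G q L) :
    DepthGE G p L := by
  induction q, hpq using Nat.le_induction with
  | base => exact h
  | succ q _ ih => exact ih h.of_succ

theorem mem_sup_span_singleton {L : Ideal R} {f z : R} :
    z ∈ L ⊔ Ideal.span {f} ↔ ∃ l ∈ L, ∃ w, z = l + f * w := by
  rw [Submodule.mem_sup]
  constructor
  · rintro ⟨l, hl, y, hy, rfl⟩
    obtain ⟨w, rfl⟩ := Ideal.mem_span_singleton'.1 hy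
    exact ⟨l, hl, w, by ring⟩
  · rintro ⟨l, hl, w, rfl⟩
    exact ⟨l, hl, f * w, Ideal.mem_span_singleton'.2 ⟨w, by ring⟩, rfl⟩

/-- For `f` and `g` in `G`, both socles compute the same `Ext¹`. Concretely, if `z` is a socle
element modulo `(L, f)` and `g z = l + f w`, then `w` is a socle element modulo `(L, g)`. -/
theorem SocleFree.of_sup_span {G : Set R} {L : Ideal R} {f g : R}
    (hfr : IsRegularMod L f) (hgr : IsRegularMod L g) (hg : g ∈ G)
    (h : SocleFree G (L ⊔ Ideal.span {g})) : SocleFree G (L ⊔ Ideal.span {f}) := by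
  intro z hz
  obtain ⟨l, hl, w, hw⟩ := mem_sup_span_singleton.1 (hz g hg)
  have hwm : w ∈ L ⊔ Ideal.span {g} := by
    refine h w fun i hi => ?_
    obtain ⟨l', hl', v, hv⟩ := mem_sup_span_singleton.1 (hz i hi)
    have : f * (i * w - g * v) ∈ L := by
      have e : f * (i * w - g * v) = g * l' - i * l := by
        linear_combination g * hv - i * hw
      rw [e]
      exact L.sub_mem (L.mul_mem_left _ hl') (L.mul_mem_left _ hl)
    exact mem_sup_span_singleton.2 ⟨_, hfr _ this, v, by ring⟩
  obtain ⟨a, ha, b, rfl⟩ := mem_sup_span_singleton.1 hwm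
  have : g * (z - f * b) ∈ L := by
    have e : g * (z - f * b) = l + f * a := by linear_combination hw
    rw [e]
    exact L.add_mem hl (L.mul_mem_left _ ha)
  exact mem_sup_span_singleton.2 ⟨_, hgr _ this, b, by ring⟩

theorem IsRegularMod.swap {L : Ideal R} {f h : R} (hf : IsRegularMod L f)
    (hh : IsRegularMod (L ⊔ Ideal.span {f}) h) :
    IsRegularMod (L ⊔ Ideal.span {h}) f := by
  intro a ha
  obtain ⟨l, hl, b, hb⟩ := mem_sup_span_singleton.1 ha
  have : b ∈ L ⊔ Ideal.span {f} :=
    hh b (mem_sup_span_singleton.2 ⟨-l, L.neg_mem hl, a, by linear_combination -hb⟩)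
  obtain ⟨l', hl', c, rfl⟩ := mem_sup_span_singleton.1 this
  have : f * (a - h * c) ∈ L := by
    have e : f * (a - h * c) = l + h * l' := by linear_combination hb
    rw [e]
    exact L.add_mem hl (L.mul_mem_left _ hl')
  exact mem_sup_span_singleton.2 ⟨_, hf _ this, c, by ring⟩

theorem mem_colon_singleton' {L : Ideal R} {x z : R} : z ∈ L.colon {x} ↔ z * x ∈ L :=
  Submodule.mem_colon_singleton

/-- Regularity of `f` on `R/(L, x)` keeps `0 → R/(L : x) → R/L → R/(L, x) → 0` exact modulo `f`;
this drives the inductions in the depth lemma. -/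
theorem colon_sup_span {L : Ideal R} {x f : R} (hf : IsRegularMod (L ⊔ Ideal.span {x}) f) :
    (L ⊔ Ideal.span {f}).colon {x} = L.colon {x} ⊔ Ideal.span {f} := by
  ext z
  rw [mem_colon_singleton', mem_sup_span_singleton, mem_sup_span_singleton]
  constructor
  · rintro ⟨l, hl, w, hw⟩
    have : f * w ∈ L ⊔ Ideal.span {x} :=
      mem_sup_span_singleton.2 ⟨-l, L.neg_mem hl, z, by linear_combination -hw⟩
    obtain ⟨l', hl', v, rfl⟩ := mem_sup_span_singleton.1 (hf w this)
    refine ⟨z - f * v, ?_, v, by ring⟩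
    rw [mem_colon_singleton', show (z - f * v) * x = l + f * l' by linear_combination hw]
    exact L.add_mem hl (L.mul_mem_left _ hl')
  · rintro ⟨a, ha, v, rfl⟩
    exact ⟨a * x, mem_colon_singleton'.1 ha, v * x, by ring⟩

section Noetherian

variable [IsNoetherianRing R] {G : Set R}

/-- If every element of `G` were a zero divisor modulo some `L ∈ s`, prime avoidance would put `G`
inside one associated prime, the annihilator of a nonzero class, contradicting `SocleFree`. -/
theorem exists_isRegularMod (hG : AvoidsPrimes G) (s : Set (Ideal R)) (hs : s.Finite)
    (h : ∀ L ∈ s, SocleFree G L) : ∃ f ∈ G, ∀ L ∈ s, IsRegularMod L f := by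
  by_contra! hcon
  have := hG (⋃ L ∈ s, associatedPrimes R (R ⧸ L))
    (hs.biUnion fun L _ => associatedPrimes.finite R (R ⧸ L))
    (by
      intro P hP
      obtain ⟨L, _, hP⟩ := Set.mem_iUnion₂.1 hP
      exact IsAssociatedPrime.isPrime hP)
    (by
      intro g hg
      obtain ⟨L, hL, hgL⟩ := hcon g hg
      simp only [IsRegularMod, not_forall] at hgL
      obtain ⟨z, hz, hzL⟩ := hgL
      have : g ∈ ⋃ p ∈ associatedPrimes R (R ⧸ L), (p : Set R) := by
        rw [biUnion_associatedPrimes_eq_zero_divisors]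
        refine ⟨Ideal.Quotient.mk L z, fun h0 => hzL (Ideal.Quotient.eq_zero_iff_mem.1 h0), ?_⟩
        rw [← Ideal.Quotient.eq_zero_iff_mem, map_mul] at hz
        exact hz
      obtain ⟨P, hP, hgP⟩ := Set.mem_iUnion₂.1 this
      exact Set.mem_iUnion₂.2 ⟨P, Set.mem_iUnion₂.2 ⟨L, hL, hP⟩, hgP⟩)
  obtain ⟨P, hP, hGP⟩ := this
  obtain ⟨L, hL, hP⟩ := Set.mem_iUnion₂.1 hP
  obtain ⟨hprime, x, rfl⟩ := isAssociatedPrime_iff.1 hP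
  obtain ⟨z, rfl⟩ := Ideal.Quotient.mk_surjective x
  have hz : z ∈ L := by
    refine h L hL z fun g hg => ?_
    have := Submodule.mem_colon_singleton.1 (hGP hg)
    rw [← Ideal.Quotient.eq_zero_iff_mem, map_mul]
    exact this
  apply hprime.ne_top
  rw [Ideal.eq_top_iff_one, Submodule.mem_colon_singleton, Ideal.Quotient.eq_zero_iff_mem.2 hz]
  simp

/-- The choice of first element does not matter: with `h` regular modulo both `(L, f)` and `(L, g)`,
exchange elements along `(f, h) → (h, f) → (h, g) → (g, h)`. -/
theorem DepthGE.sup_span_of_isRegularMod (hG : AvoidsPrimes G) {p : ℕ} :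
    ∀ {L : Ideal R} {f g : R}, f ∈ G → g ∈ G → IsRegularMod L f → IsRegularMod L g →
      DepthGE G p (L ⊔ Ideal.span {f}) → DepthGE G p (L ⊔ Ideal.span {g}) := by
  induction p with
  | zero => intros; trivial
  | succ p ih =>
    intro L f g hf hg hfr hgr hd
    have hsf := hd.socleFree
    have hsg := hsf.of_sup_span hgr hfr hf
    obtain ⟨h, hh, hr⟩ := exists_isRegularMod hG {L ⊔ Ideal.span {f}, L ⊔ Ideal.span {g}}
      (by simp) (by
        rintro _ (rfl | rfl)
        · exact hsf
        · exact hsg)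
    have hr2 := hr (L ⊔ Ideal.span {f}) (by simp)
    have hr3 := hr (L ⊔ Ideal.span {g}) (by simp)
    refine ⟨h, hh, hr3, ?_⟩
    obtain ⟨f', hf', hfr', hd'⟩ := hd
    have := ih hf' hh hfr' hr2 hd'
    rw [sup_right_comm] at this ⊢
    exact ih hf hg (hfr.swap hr2) (hgr.swap hr3) this

theorem DepthGE.sup_span (hG : AvoidsPrimes G) {p : ℕ} {L : Ideal R} {g : R} (hg : g ∈ G)
    (hgr : IsRegularMod L g) (h : DepthGE G (p + 1) L) : DepthGE G p (L ⊔ Ideal.span {g}) := by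
  obtain ⟨f, hf, hfr, hd⟩ := h
  exact hd.sup_span_of_isRegularMod hG hf hg hfr hgr

/-- The depth lemma for the middle term of `0 → R/(L:x) → R/L → R/(L,x) → 0`. -/
theorem DepthGE.of_colon_of_sup (hG : AvoidsPrimes G) {x : R} {p : ℕ} :
    ∀ {L : Ideal R}, DepthGE G p (L.colon {x}) → DepthGE G p (L ⊔ Ideal.span {x}) →
      DepthGE G p L := by
  induction p with
  | zero => intros; trivial
  | succ p ih =>
    intro L hA hC
    have hs : SocleFree G L := by
      intro z hz
      obtain ⟨l, hl, w, rfl⟩ := mem_sup_span_singleton.1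
        (hC.socleFree z fun g hg => Ideal.mem_sup_left (hz g hg))
      refine L.add_mem hl ?_
      rw [mul_comm, ← mem_colon_singleton']
      refine hA.socleFree w fun g hg => mem_colon_singleton'.2 ?_
      have := L.sub_mem (hz g hg) (L.mul_mem_left g hl)
      convert this using 1
      ring
    obtain ⟨f, hf, hr⟩ := exists_isRegularMod hG {L, L.colon {x}, L ⊔ Ideal.span {x}}
      (by simp) (by
        rintro _ (rfl | rfl | rfl)
        · exact hs
        · exact hA.socleFree
        · exact hC.socleFree)
    have hrC := hr (L ⊔ Ideal.span {x}) (by simp)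
    refine ⟨f, hf, hr L (by simp), ih ?_ ?_⟩
    · rw [colon_sup_span hrC]
      exact hA.sup_span hG hf (hr _ (by simp))
    · rw [sup_right_comm]
      exact hC.sup_span hG hf hrC

/-- The depth lemma for the last term of `0 → R/(L:x) → R/L → R/(L,x) → 0`. -/
theorem DepthGE.sup_of_colon (hG : AvoidsPrimes G) {x : R} {p : ℕ} :
    ∀ {L : Ideal R}, DepthGE G (p + 1) (L.colon {x}) → DepthGE G p L →
      DepthGE G p (L ⊔ Ideal.span {x}) := by
  induction p with
  | zero => intros; trivial
  | succ p ih =>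
    intro L hA hB
    -- The connecting map: if `z` is a socle element of `R/(L, x)` and `f z = l + x w`, then `w` is
    -- a socle element of `R/((L : x), f)`, hence zero there because `R/(L : x)` has depth at least
    -- two.
    have hs : SocleFree G (L ⊔ Ideal.span {x}) := by
      obtain ⟨f, hf, hr⟩ := exists_isRegularMod hG {L, L.colon {x}}
        (by simp) (by
          rintro _ (rfl | rfl)
          · exact hB.socleFree
          · exact hA.socleFree)
      have hrA := hr (L.colon {x}) (by simp)
      have hAf := (hA.sup_span hG hf hrA).socleFree
      intro z hz
      obtain ⟨l, hl, w, hw⟩ := mem_sup_span_singleton.1 (hz f hf)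
      have hwm : w ∈ L.colon {x} ⊔ Ideal.span {f} := by
        refine hAf w fun g hg => ?_
        obtain ⟨l', hl', v, hv⟩ := mem_sup_span_singleton.1 (hz g hg)
        refine mem_sup_span_singleton.2 ⟨g * w - f * v, mem_colon_singleton'.2 ?_, v, by ring⟩
        rw [show (g * w - f * v) * x = f * l' - g * l by linear_combination f * hv - g * hw]
        exact L.sub_mem (L.mul_mem_left _ hl') (L.mul_mem_left _ hl)
      obtain ⟨a, ha, b, rfl⟩ := mem_sup_span_singleton.1 hwm
      refine mem_sup_span_singleton.2 ⟨z - x * b, hr L (by simp) _ ?_, b, by ring⟩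
      rw [show f * (z - x * b) = l + a * x by linear_combination hw]
      exact L.add_mem hl (mem_colon_singleton'.1 ha)
    obtain ⟨f, hf, hr⟩ := exists_isRegularMod hG {L, L.colon {x}, L ⊔ Ideal.span {x}}
      (by simp) (by
        rintro _ (rfl | rfl | rfl)
        · exact hB.socleFree
        · exact hA.socleFree
        · exact hs)
    have hrC := hr (L ⊔ Ideal.span {x}) (by simp)
    refine ⟨f, hf, hrC, ?_⟩
    rw [sup_right_comm]
    refine ih ?_ ?_
    · rw [colon_sup_span hrC]
      exact hA.sup_span hG hf (hr _ (by simp))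
    · exact hB.sup_span hG hf (hr _ (by simp))

end Noetherian

theorem depthGE_comap_iff {A : Type*} [CommRing A] {φ : R →+* A} (hφ : Function.Surjective φ)
    (G : Set R) {p : ℕ} : ∀ L : Ideal A, DepthGE G p (L.comap φ) ↔ DepthGE (φ '' G) p L := by
  induction p with
  | zero => intro L; exact Iff.rfl
  | succ p ih =>
    intro L
    have hreg (f : R) : IsRegularMod (L.comap φ) f ↔ IsRegularMod L (φ f) := by
      simp [IsRegularMod, hφ.forall]
    have hsup (f : R) : L.comap φ ⊔ Ideal.span {f} = (L ⊔ Ideal.span {φ f}).comap φ := by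
      ext z
      simp only [mem_sup_span_singleton, Ideal.mem_comap]
      constructor
      · rintro ⟨l, hl, w, rfl⟩
        exact ⟨φ l, hl, φ w, by simp⟩
      · rintro ⟨l, hl, w, hw⟩
        obtain ⟨w, rfl⟩ := hφ w
        exact ⟨z - f * w, by simpa [hw] using hl, w, by ring⟩
    simp only [DepthGE, Set.exists_mem_image, hreg, hsup, ih]

end DepthOfIdeals

/-! ### Comparison with regular sequences on quotient modules -/

section Bridge

open RingTheory.Sequence

variable {R : Type*} [CommRing R]

theorem isSMulRegular_quotient_iff {L : Ideal R} {f : R} :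
    IsSMulRegular (R ⧸ L) f ↔ IsRegularMod L f := by
  rw [isSMulRegular_iff_right_eq_zero_of_smul]
  simp only [Ideal.Quotient.mk_surjective.forall, IsRegularMod, ← Ideal.Quotient.eq_zero_iff_mem,
    map_mul]
  rfl

open scoped Pointwise in
theorem smul_top_quotient (L : Ideal R) (f : R) :
    f • (⊤ : Submodule R (R ⧸ L)) = Submodule.map L.mkQ (L ⊔ Ideal.span {f}) := by
  ext z
  obtain ⟨z, rfl⟩ := L.mkQ_surjective z
  rw [Submodule.mem_smul_pointwise_iff_exists]
  constructor
  · rintro ⟨w, -, hw⟩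
    obtain ⟨w, rfl⟩ := L.mkQ_surjective w
    exact ⟨f * w, Ideal.mem_sup_right (Ideal.mem_span_singleton'.2 ⟨w, mul_comm _ _⟩), hw⟩
  · rintro ⟨y, hy, hyz⟩
    obtain ⟨l, hl, w, rfl⟩ := mem_sup_span_singleton.1 hy
    refine ⟨L.mkQ w, trivial, ?_⟩
    have hl0 : L.mkQ l = 0 := (Submodule.Quotient.mk_eq_zero L).2 hl
    rw [← hyz, map_add, hl0, zero_add]
    rfl

/-- `(R / L) / f (R / L) ≃ R / (L, f)`. -/
noncomputable def quotSMulTopQuotientEquiv (L : Ideal R) (f : R) :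
    QuotSMulTop f (R ⧸ L) ≃ₗ[R] R ⧸ (L ⊔ Ideal.span {f}) :=
  (Submodule.quotEquivOfEq _ _ (smul_top_quotient L f)).trans
    (Submodule.quotientQuotientEquivQuotient L (L ⊔ Ideal.span {f}) le_sup_left)

theorem depthGE_iff_exists_isWeaklyRegular (G : Set R) {p : ℕ} : ∀ L : Ideal R,
    DepthGE G p L ↔
      ∃ rs : List R, rs.length = p ∧ IsWeaklyRegular (R ⧸ L) rs ∧ ∀ r ∈ rs, r ∈ G := by
  induction p with
  | zero =>
    intro L
    simp only [DepthGE, true_iff]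
    exact ⟨[], by simp⟩
  | succ p ih =>
    intro L
    have key (f : R) (rs : List R) : IsWeaklyRegular (R ⧸ L) (f :: rs) ↔
        IsRegularMod L f ∧ IsWeaklyRegular (R ⧸ (L ⊔ Ideal.span {f})) rs := by
      rw [isWeaklyRegular_cons_iff, isSMulRegular_quotient_iff,
        (quotSMulTopQuotientEquiv L f).isWeaklyRegular_congr]
    constructor
    · rintro ⟨f, hf, hr, hd⟩
      obtain ⟨rs, rfl, hrs, hG⟩ := (ih _).1 hd
      exact ⟨f :: rs, by simp, (key f rs).2 ⟨hr, hrs⟩, by simpa using ⟨hf, hG⟩⟩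
    · rintro ⟨rs, hl, hrs, hG⟩
      obtain ⟨f, rs, rfl⟩ := List.exists_cons_of_length_eq_add_one hl
      obtain ⟨h1, h2⟩ := (key f rs).1 hrs
      refine ⟨f, hG f (by simp), h1, (ih _).2 ⟨rs, by simpa using hl, h2, ?_⟩⟩
      exact fun r hr => hG r (by simp [hr])

/-- Weakly regular sequences in `I` are automatically regular here: were their quotient zero, `1`
would lie in `I + L = I`. -/
theorem natCast_le_gradedDepth_iff {I L : Ideal R} (hI : I ≠ ⊤) (hL : L ≤ I) {p : ℕ} :
    (p : ℕ∞) ≤ gradedDepth I (R ⧸ L) ↔ DepthGE (I : Set R) p L := by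
  constructor
  · intro h
    cases p with
    | zero => trivial
    | succ p =>
      have : (p : ℕ∞) < gradedDepth I (R ⧸ L) := lt_of_lt_of_le (by exact_mod_cast p.lt_succ_self) h
      simp only [gradedDepth, lt_iSup_iff] at this
      obtain ⟨rs, ⟨hr, hmem⟩, hlt⟩ := this
      exact ((depthGE_iff_exists_isWeaklyRegular _ L).2 ⟨rs, rfl, hr.1, hmem⟩).mono
        (by exact_mod_cast hlt)
  · intro h
    obtain ⟨rs, rfl, hr, hmem⟩ := (depthGE_iff_exists_isWeaklyRegular _ L).1 h
    refine le_iSup₂_of_le rs ⟨⟨hr, fun htop => hI ?_⟩, hmem⟩ le_rfl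
    have h1 : Ideal.ofList rs ≤ I := Ideal.span_le.2 hmem
    have h2 : (Ideal.Quotient.mk L 1) ∈ (Ideal.ofList rs • ⊤ : Submodule R (R ⧸ L)) :=
      htop ▸ trivial
    have h3 : (Ideal.ofList rs • ⊤ : Submodule R (R ⧸ L)) ≤ Submodule.map L.mkQ I := by
      rw [Submodule.smul_le]
      rintro r hr n -
      obtain ⟨n, rfl⟩ := L.mkQ_surjective n
      exact ⟨r * n, I.mul_mem_right _ (h1 hr), rfl⟩
    obtain ⟨y, hy, hy1⟩ := h3 h2
    have h4 : y - 1 ∈ L := (Submodule.Quotient.eq L).1 hy1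
    rw [Ideal.eq_top_iff_one]
    simpa using I.sub_mem hy (hL h4)

theorem DepthGE.map_ringEquiv {A : Type*} [CommRing A] (e : R ≃+* A) (G : Set R) {p : ℕ}
    (L : Ideal R) : DepthGE (e '' G) p (L.map e) ↔ DepthGE G p L := by
  have := depthGE_comap_iff (φ := (e : R →+* A)) e.surjective G (p := p) (L.map e)
  rw [show (L.map e).comap (e : R →+* A) = L from Ideal.comap_map_of_bijective e e.bijective] at this
  exact this.symm

end Bridge

/-! ### Degree-homogeneous ideals of a polynomial ring in one variable -/

namespace Polynomial

open scoped Polynomial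

variable {A : Type*} [CommRing A]

/-- An ideal of `A[X]` that is homogeneous for the grading by degree. -/
def IsDegreeHomogeneous (L : Ideal A[X]) : Prop :=
  ∀ f ∈ L, ∀ a, monomial a (f.coeff a) ∈ L

theorem IsDegreeHomogeneous.sup_span_C {L : Ideal A[X]} (hL : IsDegreeHomogeneous L) (c : A) :
    IsDegreeHomogeneous (L ⊔ Ideal.span {C c}) := by
  intro f hf a
  obtain ⟨l, hl, w, rfl⟩ := mem_sup_span_singleton.1 hf
  refine mem_sup_span_singleton.2 ⟨_, hL l hl a, monomial a (w.coeff a), ?_⟩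
  simp [C_mul_monomial]

/-- Let `N` be the submodule of `A[X]/L` killed by `I`. A regular element `y = y' + X g` acts on `N`
as `X g`, so `g N` is killed by `(I, X)` modulo `y`. The second unit of depth then gives `N = X N`,
and `N = 0` by comparing coefficients from degree zero upwards. -/
theorem socleFree_C_of_depthGE {I : Ideal A} {L : Ideal A[X]} (hL : IsDegreeHomogeneous L)
    (h : DepthGE ((I.map C ⊔ Ideal.span {X} : Ideal A[X]) : Set A[X]) 2 L) :
    SocleFree (C '' (I : Set A)) L := by
  obtain ⟨y, hy, hyr, hs⟩ := h
  replace hs := hs.socleFree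
  obtain ⟨y', hy', g, rfl⟩ := mem_sup_span_singleton.1 hy
  have hIN (N : A[X]) : (∀ c ∈ C '' (I : Set A), c * N ∈ L) → ∀ q ∈ I.map C, q * N ∈ L := by
    intro h q hq
    rw [← mem_colon_singleton']
    refine Ideal.map_le_iff_le_comap.2 (fun c hc => ?_) hq
    exact mem_colon_singleton'.2 (h _ ⟨c, hc, rfl⟩)
  have step (z : A[X]) (hz : ∀ c ∈ C '' (I : Set A), c * z ∈ L) :
      ∃ w, (∀ c ∈ C '' (I : Set A), c * w ∈ L) ∧ z - X * w ∈ L := by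
    have hgz : g * z ∈ L ⊔ Ideal.span {y' + X * g} := by
      refine hs _ fun q hq => ?_
      obtain ⟨q', hq', v, rfl⟩ := mem_sup_span_singleton.1 hq
      refine mem_sup_span_singleton.2 ⟨g * (q' * z) - v * (y' * z), ?_, v * z, by ring⟩
      exact L.sub_mem (L.mul_mem_left _ (hIN z hz q' hq')) (L.mul_mem_left _ (hIN z hz y' hy'))
    obtain ⟨l, hl, w, hw⟩ := mem_sup_span_singleton.1 hgz
    have hwN : ∀ c ∈ C '' (I : Set A), c * w ∈ L := fun c hc => by
      refine hyr _ ?_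
      rw [show (y' + X * g) * (c * w) = g * (c * z) - c * l by linear_combination -c * hw]
      exact L.sub_mem (L.mul_mem_left _ (hz c hc)) (L.mul_mem_left _ hl)
    refine ⟨w, hwN, hyr _ ?_⟩
    rw [show (y' + X * g) * (z - X * w) = y' * z + X * l by linear_combination X * hw]
    exact L.add_mem (hIN z hz y' hy') (L.mul_mem_left _ hl)
  have key (a : ℕ) : ∀ z : A[X], (∀ c ∈ C '' (I : Set A), c * z ∈ L) →
      monomial a (z.coeff a) ∈ L := by
    induction a with
    | zero =>
      intro z hz
      obtain ⟨w, -, hw⟩ := step z hz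
      simpa using hL _ hw 0
    | succ a ih =>
      intro z hz
      obtain ⟨w, hwN, hw⟩ := step z hz
      have h1 := hL _ hw (a + 1)
      have h2 := L.mul_mem_left X (ih w hwN)
      rw [X_mul_monomial] at h2
      simpa [coeff_X_mul, ← map_add] using L.add_mem h1 h2
  intro z hz
  rw [z.as_sum_support]
  exact L.sum_mem fun a _ => key a z hz

/-- While the depth is at least two, the previous lemma supplies a regular element free of `X`, and
dividing by it preserves homogeneity. Only the last unit of depth may require `X`. -/
theorem _root_.DepthGE.C_image [IsNoetherianRing A] {I : Ideal A} {p : ℕ} :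
    ∀ {L : Ideal A[X]}, IsDegreeHomogeneous L →
      DepthGE ((I.map C ⊔ Ideal.span {X} : Ideal A[X]) : Set A[X]) (p + 1) L →
      DepthGE (C '' (I : Set A)) p L := by
  induction p with
  | zero => intros; trivial
  | succ p ih =>
    intro L hL h
    obtain ⟨_, ⟨f, hf, rfl⟩, hr⟩ := exists_isRegularMod (I.avoidsPrimes.image_comap C) {L} (by simp)
      (by rintro _ rfl; exact socleFree_C_of_depthGE hL (h.mono (by omega)))
    have hr := hr L rfl
    exact ⟨C f, ⟨f, hf, rfl⟩, hr, ih (hL.sup_span_C f)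
      (h.sup_span (Ideal.avoidsPrimes _) (Ideal.mem_sup_left (Ideal.mem_map_of_mem C hf)) hr)⟩

theorem IsDegreeHomogeneous.comap_C_sup_span {L : Ideal A[X]} (hL : IsDegreeHomogeneous L) (c : A) :
    (L ⊔ Ideal.span {C c}).comap C = L.comap C ⊔ Ideal.span {c} := by
  ext z
  simp only [Ideal.mem_comap, mem_sup_span_singleton]
  constructor
  · rintro ⟨l, hl, w, hw⟩
    refine ⟨l.coeff 0, hL l hl 0, w.coeff 0, ?_⟩
    simpa using congr_arg (coeff · 0) hw
  · rintro ⟨l, hl, w, rfl⟩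
    exact ⟨C l, hl, C w, by simp⟩

/-- By homogeneity `A/(L ∩ A)` is the degree-zero summand of `A[X]/L`, and multiplication by
constants respects degrees. -/
theorem _root_.DepthGE.comap_C {I : Set A} {p : ℕ} :
    ∀ {L : Ideal A[X]}, IsDegreeHomogeneous L → DepthGE (C '' I) p L →
      DepthGE I p (L.comap C) := by
  induction p with
  | zero => intros; trivial
  | succ p ih =>
    rintro L hL ⟨_, ⟨f, hf, rfl⟩, hr, hd⟩
    refine ⟨f, hf, fun z hz => hr _ (by simpa using hz), ?_⟩
    rw [← hL.comap_C_sup_span]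
    exact ih (hL.sup_span_C f) hd

theorem IsDegreeHomogeneous.sup_span_X {L : Ideal A[X]} (hL : IsDegreeHomogeneous L) :
    L ⊔ Ideal.span {X} = (L.comap C).comap constantCoeff := by
  ext z
  simp only [Ideal.mem_comap, mem_sup_span_singleton]
  constructor
  · rintro ⟨l, hl, w, rfl⟩
    simpa using hL l hl 0
  · intro h
    refine ⟨_, h, z.divX, ?_⟩
    simp [add_comm, X_mul_divX_add]

theorem IsDegreeHomogeneous.depthGE_sup_span_X {L : Ideal A[X]} (hL : IsDegreeHomogeneous L)
    {I : Ideal A} {p : ℕ} :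
    DepthGE ((I.map C ⊔ Ideal.span {X} : Ideal A[X]) : Set A[X]) p (L ⊔ Ideal.span {X}) ↔
      DepthGE (I : Set A) p (L.comap C) := by
  rw [hL.sup_span_X, depthGE_comap_iff constantCoeff_surjective]
  congr! 1
  ext a
  constructor
  · rintro ⟨q, hq, rfl⟩
    obtain ⟨l, hl, w, rfl⟩ := mem_sup_span_singleton.1 hq
    have : l ∈ I.comap constantCoeff :=
      Ideal.map_le_iff_le_comap.2 (fun c hc => by simpa using hc) hl
    simpa using this
  · intro ha
    exact ⟨C a, Ideal.mem_sup_left (Ideal.mem_map_of_mem C ha), by simp⟩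

end Polynomial

/-! ### Coefficient ideals of powers of `I + X J` -/

section CoeffPowers

variable {A : Type*} [CommRing A]

theorem Ideal.pow_mul_pow_le_pow_mul_pow {I J : Ideal A} (hIJ : I ≤ J) {a b c d : ℕ} (hca : c ≤ a)
    (h : c + d ≤ a + b) : I ^ a * J ^ b ≤ I ^ c * J ^ d := by
  obtain ⟨r, rfl⟩ := Nat.exists_eq_add_of_le hca
  rw [pow_add, mul_assoc]
  refine Ideal.mul_mono_right ?_
  calc I ^ r * J ^ b ≤ J ^ r * J ^ b := Ideal.mul_mono_left (Ideal.pow_right_mono hIJ r)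
    _ = J ^ (r + b) := (pow_add _ _ _).symm
    _ ≤ J ^ d := Ideal.pow_le_pow_right (by omega)

namespace Polynomial

open scoped Polynomial

/-- The ideal `I + X J` of `A[X]`. -/
noncomputable def linearExtension (I J : Ideal A) : Ideal A[X] :=
  I.map C ⊔ Ideal.span {X} * J.map C

theorem coeff_mem_of_mem_linearExtension {I J : Ideal A} (hIJ : I ≤ J) {f : A[X]}
    (hf : f ∈ linearExtension I J) (a : ℕ) : f.coeff a ∈ I ^ (1 - a) * J ^ min a 1 := by
  obtain ⟨g, hg, q, hq, rfl⟩ := Submodule.mem_sup.1 hf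
  obtain ⟨h, hh, rfl⟩ := Ideal.mem_span_singleton_mul.1 hq
  rw [Ideal.mem_map_C_iff] at hg hh
  cases a with
  | zero => simpa using hg 0
  | succ a => simpa [coeff_X_mul] using J.add_mem (hIJ (hg (a + 1))) (hh a)

/-- Each factor contributes `I` or `X J`, and `I ≤ J` lets factors of `I` be traded for `J` when
degrees are larger than needed. For `a > t` the truncated `t - a` and `min a t` give `J ^ t`. -/
theorem mem_linearExtension_pow_iff {I J : Ideal A} (hIJ : I ≤ J) (t : ℕ) (f : A[X]) :
    f ∈ linearExtension I J ^ t ↔ ∀ a, f.coeff a ∈ I ^ (t - a) * J ^ min a t := by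
  constructor
  · induction t generalizing f with
    | zero => simp
    | succ t ih =>
      intro hf
      rw [pow_succ] at hf
      induction hf using Submodule.mul_induction_on' with
      | mem_mul_mem g hg h hh =>
        intro a
        rw [coeff_mul]
        refine Ideal.sum_mem _ fun ij hij => ?_
        obtain ⟨i, j⟩ := ij
        have hij : i + j = a := by simpa using hij
        have := Ideal.mul_mem_mul (ih g hg i) (coeff_mem_of_mem_linearExtension hIJ hh j)
        rw [mul_mul_mul_comm, ← pow_add, ← pow_add] at this
        exact Ideal.pow_mul_pow_le_pow_mul_pow hIJ (by omega) (by omega) this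
      | add g _ h _ hg hh =>
        intro a
        rw [coeff_add]
        exact Ideal.add_mem _ (hg a) (hh a)
  · intro hf
    rw [f.as_sum_support]
    refine Ideal.sum_mem _ fun a _ => ?_
    have h1 : C (f.coeff a) ∈ (I.map C) ^ (t - a) * (J.map C) ^ min a t := by
      rw [← Ideal.map_pow, ← Ideal.map_pow, ← Ideal.map_mul]
      exact Ideal.mem_map_of_mem C (hf a)
    have h2 : (X ^ a : A[X]) ∈ Ideal.span {X} ^ min a t := by
      rw [Ideal.span_singleton_pow, Ideal.mem_span_singleton]
      exact pow_dvd_pow _ (min_le_left _ _)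
    rw [← C_mul_X_pow_eq_monomial]
    have h3 := Ideal.mul_mem_mul h1 h2
    rw [mul_assoc, mul_comm (J.map C ^ _), ← mul_pow] at h3
    have h4 : (I.map C) ^ (t - a) * (Ideal.span {X} * J.map C) ^ min a t ≤
        linearExtension I J ^ (t - a) * linearExtension I J ^ min a t :=
      Ideal.mul_mono (Ideal.pow_right_mono le_sup_left _) (Ideal.pow_right_mono le_sup_right _)
    rw [← pow_add, show t - a + min a t = t by omega] at h4
    exact h4 h3

/-- The ideal `((I + X J) ^ t : X ^ k)` of `A[X]`. -/
noncomputable def linearExtensionColon (I J : Ideal A) (t k : ℕ) : Ideal A[X] :=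
  (linearExtension I J ^ t).colon {X ^ k}

theorem mem_linearExtensionColon_iff {I J : Ideal A} (hIJ : I ≤ J) (t k : ℕ) (f : A[X]) :
    f ∈ linearExtensionColon I J t k ↔
      ∀ a, f.coeff a ∈ I ^ (t - (a + k)) * J ^ min (a + k) t := by
  rw [linearExtensionColon, mem_colon_singleton', mem_linearExtension_pow_iff hIJ]
  constructor
  · intro h a
    simpa [coeff_mul_X_pow] using h (a + k)
  · intro h a
    rw [coeff_mul_X_pow']
    split_ifs with hka
    · simpa [Nat.sub_add_cancel hka] using h (a - k)
    · exact Ideal.zero_mem _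

theorem isDegreeHomogeneous_linearExtensionColon {I J : Ideal A} (hIJ : I ≤ J) (t k : ℕ) :
    IsDegreeHomogeneous (linearExtensionColon I J t k) := by
  intro f hf a
  rw [mem_linearExtensionColon_iff hIJ] at hf ⊢
  intro b
  rw [coeff_monomial]
  split_ifs with h
  · exact h ▸ hf a
  · exact Ideal.zero_mem _

theorem comap_C_linearExtensionColon {I J : Ideal A} (hIJ : I ≤ J) {t k : ℕ} (hk : k ≤ t) :
    (linearExtensionColon I J t k).comap C = I ^ (t - k) * J ^ k := by
  ext c
  rw [Ideal.mem_comap, mem_linearExtensionColon_iff hIJ]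
  constructor
  · intro h
    simpa [hk] using h 0
  · intro h a
    rw [coeff_C]
    split_ifs with ha
    · simpa [ha, hk] using h
    · exact Ideal.zero_mem _

theorem linearExtensionColon_colon (I J : Ideal A) (t k : ℕ) :
    (linearExtensionColon I J t k).colon {X} = linearExtensionColon I J t (k + 1) := by
  ext f
  simp only [linearExtensionColon, mem_colon_singleton', mul_assoc, pow_succ']

end Polynomial

end CoeffPowers

/-! ### Splitting off the last variable from the cycle path ideal -/

section PathIdeals

variable (K : Type*) [Field K] (N : ℕ)

/-- The isomorphism `K[x_0, …, x_N] ≃ K[x_0, …, x_{N-1}][X]` sending the last variable to `X`. -/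
noncomputable def lastVarEquiv :
    MvPolynomial (Fin (N + 1)) K ≃ₐ[K] Polynomial (MvPolynomial (Fin N) K) :=
  (renameEquiv K (finSuccEquivLast (n := N))).trans (optionEquivLeft K (Fin N))

/-- The inclusion `K[x_0, …, x_{N-1}] → K[x_0, …, x_N]`. -/
noncomputable def initialInclusion : MvPolynomial (Fin N) K →ₐ[K] MvPolynomial (Fin (N + 1)) K :=
  rename (Fin.castLE (Nat.sub_le (N + 1) 1))

variable {K N}

theorem initialInclusion_X (i : Fin N) : initialInclusion K N (X i) = X i.castSucc :=
  rename_X _ _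

theorem lastVarEquiv_X_last : lastVarEquiv K N (X (Fin.last N)) = Polynomial.X := by
  simp [lastVarEquiv]

theorem lastVarEquiv_initialInclusion (p : MvPolynomial (Fin N) K) :
    lastVarEquiv K N (initialInclusion K N p) = Polynomial.C p := by
  have : ((lastVarEquiv K N).toAlgHom.comp (initialInclusion K N)) =
      IsScalarTower.toAlgHom K (MvPolynomial (Fin N) K) (Polynomial (MvPolynomial (Fin N) K)) := by
    ext1 i
    simp [initialInclusion_X, lastVarEquiv]
  exact DFunLike.congr_fun this p

theorem lastVarEquiv_mem_map_iff {L : Ideal (MvPolynomial (Fin (N + 1)) K)}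
    {p : MvPolynomial (Fin (N + 1)) K} :
    lastVarEquiv K N p ∈ L.map (lastVarEquiv K N) ↔ p ∈ L := by
  rw [← Ideal.mem_comap, Ideal.comap_map_of_bijective _ (lastVarEquiv K N).bijective]

theorem map_lastVarEquiv_idealOfVars :
    (idealOfVars (Fin (N + 1)) K).map (lastVarEquiv K N) =
      (idealOfVars (Fin N) K).map Polynomial.C ⊔ Ideal.span {Polynomial.X} := by
  apply le_antisymm
  · rw [Ideal.map_span, Ideal.span_le]
    rintro _ ⟨_, ⟨i, rfl⟩, rfl⟩
    refine Fin.lastCases ?_ (fun i => ?_) i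
    · rw [lastVarEquiv_X_last]
      exact Ideal.mem_sup_right (Ideal.mem_span_singleton_self _)
    · rw [← initialInclusion_X, lastVarEquiv_initialInclusion]
      exact Ideal.mem_sup_left (Ideal.mem_map_of_mem _ (Ideal.subset_span ⟨i, rfl⟩))
  · refine sup_le ?_ ?_
    · rw [Ideal.map_span, Ideal.span_le]
      rintro _ ⟨_, ⟨i, rfl⟩, rfl⟩
      rw [← lastVarEquiv_initialInclusion, initialInclusion_X]
      exact Ideal.mem_map_of_mem _ (Ideal.subset_span ⟨_, rfl⟩)
    · rw [Ideal.span_le, Set.singleton_subset_iff, ← lastVarEquiv_X_last]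
      exact Ideal.mem_map_of_mem _ (Ideal.subset_span ⟨_, rfl⟩)

theorem mem_idealOfVars_iff {σ : Type*} {p : MvPolynomial σ K} :
    p ∈ idealOfVars σ K ↔ constantCoeff p = 0 := by
  have := mem_pow_idealOfVars_iff' (σ := σ) (R := K) 1 p
  rw [pow_one] at this
  simp [this, constantCoeff_eq, Finsupp.degree_eq_zero_iff]

variable (K N) in
/-- The retraction of `K[x_0, …, x_N]` onto `K[x_N]` that kills the other variables. -/
noncomputable def lastVarRetraction : MvPolynomial (Fin (N + 1)) K →ₐ[K] Polynomial K :=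
  aeval fun i => if i = Fin.last N then Polynomial.X else 0

theorem constantCoeff_eq_coeff_lastVarRetraction (p : MvPolynomial (Fin (N + 1)) K) :
    constantCoeff p = (lastVarRetraction K N p).coeff 0 := by
  have : (constantCoeff : MvPolynomial (Fin (N + 1)) K →+* K) =
      Polynomial.constantCoeff.comp (lastVarRetraction K N : _ →+* Polynomial K) := by
    ext i
    · simp
    · by_cases h : i = Fin.last N <;> simp [lastVarRetraction, h]
  exact DFunLike.congr_fun this p

theorem lastVarRetraction_eq_zero {m : ℕ} (hm : 2 ≤ m) (hmn : m < N + 1)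
    {p : MvPolynomial (Fin (N + 1)) K} (hp : p ∈ cyclePathIdeal K (N + 1) m) :
    lastVarRetraction K N p = 0 := by
  rw [← RingHom.mem_ker]
  refine Ideal.span_le.2 ?_ hp
  rintro _ ⟨i, rfl⟩
  rw [SetLike.mem_coe, RingHom.mem_ker, map_prod, Finset.prod_eq_zero_iff]
  -- A window of length at least two contains a variable other than `x_n`: its first one, or, if
  -- that is `x_n`, the next one, which is `x_1`.
  by_cases h : (i + 0 : ℕ) % (N + 1) = N
  · refine ⟨⟨1, hm⟩, Finset.mem_univ _, ?_⟩
    have hi : (i : ℕ) = N := by rwa [add_zero, Nat.mod_eq_of_lt i.isLt] at h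
    have : (i + 1 : ℕ) % (N + 1) ≠ N := by simp [hi]; omega
    simp [lastVarRetraction, Fin.ext_iff, this]
  · refine ⟨⟨0, by omega⟩, Finset.mem_univ _, ?_⟩
    simp only [lastVarRetraction, aeval_X, Fin.ext_iff, Fin.val_last, h, if_false]

theorem lastVar_succ (hn : 0 < N + 1) : lastVar K (N + 1) hn = X (Fin.last N) := rfl

theorem mem_contractedColon_iff {m : ℕ} {hn : 0 < N + 1} {p : MvPolynomial (Fin N) K} :
    p ∈ contractedColon K (N + 1) m hn ↔
      initialInclusion K N p * X (Fin.last N) ∈ cyclePathIdeal K (N + 1) m :=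
  mem_colon_singleton'

/-- The retraction kills `J` but sends `x_n` to a nonzero element of the domain `K[X]`, so it kills
the colon ideal too. This gives the properness needed to compare depths. -/
theorem colonIdeal_le_idealOfVars {m : ℕ} (hm : 2 ≤ m) (hmn : m < N + 1) (hn : 0 < N + 1) {t : ℕ}
    (ht : t ≠ 0) (k : ℕ) : colonIdeal K (N + 1) m hn t k ≤ idealOfVars (Fin (N + 1)) K := by
  intro p hp
  have h := lastVarRetraction_eq_zero hm hmn (Ideal.pow_le_self ht (mem_colon_singleton'.1 hp))
  rw [lastVar_succ, map_mul, map_pow] at h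
  have hX : lastVarRetraction K N (X (Fin.last N)) = Polynomial.X := by simp [lastVarRetraction]
  rw [hX, mul_eq_zero, or_iff_left (pow_ne_zero _ Polynomial.X_ne_zero)] at h
  rw [mem_idealOfVars_iff, constantCoeff_eq_coeff_lastVarRetraction, h, Polynomial.coeff_zero]

theorem contractedColon_le_idealOfVars {m : ℕ} (hm : 2 ≤ m) (hmn : m < N + 1) (hn : 0 < N + 1) :
    contractedColon K (N + 1) m hn ≤ idealOfVars (Fin N) K := by
  intro p hp
  have : initialInclusion K N p ∈ idealOfVars (Fin (N + 1)) K := by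
    refine colonIdeal_le_idealOfVars hm hmn hn one_ne_zero 1 ?_
    rw [colonIdeal, pow_one, pow_one, mem_colon_singleton']
    exact mem_contractedColon_iff.1 hp
  rw [mem_idealOfVars_iff] at this ⊢
  rw [← this, initialInclusion, constantCoeff_rename]

theorem initialInclusion_mem_cyclePathIdeal {m : ℕ} {p : MvPolynomial (Fin N) K}
    (hp : p ∈ pathIdeal K N m) : initialInclusion K N p ∈ cyclePathIdeal K (N + 1) m := by
  rw [← Ideal.mem_comap]
  refine Ideal.span_le.2 ?_ hp
  rintro _ ⟨i, hi, rfl⟩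
  rw [SetLike.mem_coe, Ideal.mem_comap]
  refine Ideal.subset_span ⟨⟨i, by omega⟩, ?_⟩
  rw [map_prod]
  refine Finset.prod_congr rfl fun j _ => ?_
  rw [initialInclusion_X]
  congr 1
  ext
  simp only [Fin.val_castSucc]
  rw [Nat.mod_eq_of_lt (by omega)]

theorem pathIdeal_le_contractedColon {m : ℕ} (hn : 0 < N + 1) :
    pathIdeal K N m ≤ contractedColon K (N + 1) m hn := fun _ hp =>
  mem_contractedColon_iff.2 (Ideal.mul_mem_right _ _ (initialInclusion_mem_cyclePathIdeal hp))

theorem exists_initialInclusion_eq_prod {m : ℕ} (hmn : m < N + 1) (i : Fin (N + 1)) :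
    (∃ p ∈ pathIdeal K N m, initialInclusion K N p =
      ∏ j : Fin m, X ⟨(i + j) % (N + 1), Nat.mod_lt _ i.pos⟩) ∨
    ∃ p, initialInclusion K N p * X (Fin.last N) =
      ∏ j : Fin m, X ⟨(i + j) % (N + 1), Nat.mod_lt _ i.pos⟩ := by
  by_cases h : (i : ℕ) + m ≤ N
  · refine Or.inl ⟨_, Ideal.subset_span ⟨i, h, rfl⟩, ?_⟩
    rw [map_prod]
    refine Finset.prod_congr rfl fun j _ => ?_
    rw [initialInclusion_X]
    congr 1
    ext
    simp only [Fin.val_castSucc]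
    rw [Nat.mod_eq_of_lt (by omega)]
  · right
    have hi := i.isLt
    -- The position where the window starting at `i` meets `x_n`; it is unique because `m ≤ N`.
    let j₀ : Fin m := ⟨N - i, by omega⟩
    have hj₀ : ((i : ℕ) + j₀) % (N + 1) = N := by
      rw [show (i : ℕ) + j₀ = N by simp only [j₀]; omega]
      exact Nat.mod_eq_of_lt (by omega)
    have hlt (j : Fin m) (hj : j ≠ j₀) : ((i : ℕ) + j) % (N + 1) < N := by
      have hj' : (j : ℕ) ≠ N - i := fun h => hj (Fin.ext h)
      have := j.isLt
      rcases lt_or_ge ((i : ℕ) + j) (N + 1) with h1 | h1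
      · rw [Nat.mod_eq_of_lt h1]; omega
      · rw [Nat.mod_eq_sub_mod h1, Nat.mod_eq_of_lt (by omega)]; omega
    refine ⟨(∏ j : {j // j ∈ Finset.univ.erase j₀},
      X ⟨(i + (j : Fin m)) % (N + 1), hlt j (Finset.ne_of_mem_erase j.2)⟩ :
        MvPolynomial (Fin N) K), ?_⟩
    rw [← Finset.prod_erase_mul _ _ (Finset.mem_univ j₀), map_prod,
      ← Finset.prod_coe_sort (Finset.univ.erase j₀)]
    congr 1
    · refine Finset.prod_congr rfl fun j _ => ?_
      rw [initialInclusion_X]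
      rfl
    · congr 1
      ext
      exact hj₀.symm

theorem map_lastVarEquiv_cyclePathIdeal {m : ℕ} (hmn : m < N + 1) (hn : 0 < N + 1) :
    (cyclePathIdeal K (N + 1) m).map (lastVarEquiv K N) =
      Polynomial.linearExtension (pathIdeal K N m) (contractedColon K (N + 1) m hn) := by
  apply le_antisymm
  · rw [cyclePathIdeal, Ideal.map_span, Ideal.span_le]
    rintro _ ⟨_, ⟨i, rfl⟩, rfl⟩
    obtain ⟨p, hp, h⟩ | ⟨p, h⟩ := exists_initialInclusion_eq_prod (K := K) hmn i
    · rw [← h, lastVarEquiv_initialInclusion]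
      exact Ideal.mem_sup_left (Ideal.mem_map_of_mem _ hp)
    · have hp : p ∈ contractedColon K (N + 1) m hn :=
        mem_contractedColon_iff.2 (Ideal.subset_span ⟨i, h⟩)
      rw [← h, map_mul, lastVarEquiv_initialInclusion, lastVarEquiv_X_last, mul_comm]
      exact Ideal.mem_sup_right (Ideal.mul_mem_mul (Ideal.mem_span_singleton_self _)
        (Ideal.mem_map_of_mem _ hp))
  · refine sup_le ?_ ?_
    · rw [Ideal.map_le_iff_le_comap]
      intro p hp
      rw [Ideal.mem_comap, ← lastVarEquiv_initialInclusion]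
      exact Ideal.mem_map_of_mem _ (initialInclusion_mem_cyclePathIdeal hp)
    · have : Ideal.map Polynomial.C (contractedColon K (N + 1) m hn) ≤
          ((cyclePathIdeal K (N + 1) m).map (lastVarEquiv K N)).colon {Polynomial.X} := by
        rw [Ideal.map_le_iff_le_comap]
        intro (p : MvPolynomial (Fin N) K) hp
        rw [Ideal.mem_comap, mem_colon_singleton', ← lastVarEquiv_X_last]
        erw [← lastVarEquiv_initialInclusion (N := N) p]
        rw [← map_mul]
        exact Ideal.mem_map_of_mem _ (mem_contractedColon_iff.1 hp)
      intro q hq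
      obtain ⟨r, hr, rfl⟩ := Ideal.mem_span_singleton_mul.1 hq
      rw [mul_comm]
      exact mem_colon_singleton'.1 (this hr)

theorem map_lastVarEquiv_colonIdeal {m : ℕ} (hmn : m < N + 1) (hn : 0 < N + 1) (t k : ℕ) :
    (colonIdeal K (N + 1) m hn t k).map (lastVarEquiv K N) =
      Polynomial.linearExtensionColon (pathIdeal K N m) (contractedColon K (N + 1) m hn) t k := by
  ext f
  obtain ⟨p, rfl⟩ := (lastVarEquiv K N).surjective f
  rw [lastVarEquiv_mem_map_iff, Polynomial.linearExtensionColon, mem_colon_singleton', colonIdeal,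
    mem_colon_singleton', ← map_lastVarEquiv_cyclePathIdeal hmn hn, ← lastVarEquiv_X_last,
    ← map_pow, ← map_mul, ← Ideal.map_pow, lastVarEquiv_mem_map_iff,
    lastVar_succ]

end PathIdeals

/-! ### The two depth claims -/

section DepthOfColonIdeals

variable {K : Type*} [Field K] {N m : ℕ}

theorem mixedIdeal_eq_comap_C (hn : 0 < N + 1) {t k : ℕ} (hk : k + 1 ≤ t) :
    (mixedIdeal K (N + 1) m hn t (k + 1) : Ideal (MvPolynomial (Fin N) K)) =
      (Polynomial.linearExtensionColon (pathIdeal K N m) (contractedColon K (N + 1) m hn) t k).comap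
        Polynomial.C := by
  rw [Polynomial.comap_C_linearExtensionColon (pathIdeal_le_contractedColon hn) (by omega),
    mixedIdeal]
  congr 2
  omega

theorem idealOfVars_ne_top {σ : Type*} : idealOfVars σ K ≠ ⊤ := by
  rw [Ne, Ideal.eq_top_iff_one, mem_idealOfVars_iff]
  simp

theorem natCast_le_quotDepth_colonIdeal_iff (hm : 2 ≤ m) (hmn : m < N + 1) (hn : 0 < N + 1)
    {t : ℕ} (ht : t ≠ 0) (k p : ℕ) :
    (p : ℕ∞) ≤ quotDepth (colonIdeal K (N + 1) m hn t k) ↔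
      DepthGE (((idealOfVars (Fin N) K).map Polynomial.C ⊔ Ideal.span {Polynomial.X} :
        Ideal (Polynomial (MvPolynomial (Fin N) K))) : Set _) p
        (Polynomial.linearExtensionColon (pathIdeal K N m) (contractedColon K (N + 1) m hn) t k) := by
  rw [quotDepth, natCast_le_gradedDepth_iff idealOfVars_ne_top
    (colonIdeal_le_idealOfVars hm hmn hn ht k), ← map_lastVarEquiv_colonIdeal hmn hn,
    ← map_lastVarEquiv_idealOfVars, ← DepthGE.map_ringEquiv (lastVarEquiv K N).toRingEquiv]
  have himage : (lastVarEquiv K N).toRingEquiv '' (idealOfVars (Fin (N + 1)) K : Set _) =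
      ((idealOfVars (Fin (N + 1)) K).map (lastVarEquiv K N) : Set _) := by
    ext f
    exact (Ideal.mem_map_of_equiv (lastVarEquiv K N) f).symm
  rw [himage]
  rfl

theorem natCast_le_quotDepth_mixedIdeal_iff (hm : 2 ≤ m) (hmn : m < N + 1) (hn : 0 < N + 1)
    {t k : ℕ} (hk : k + 1 ≤ t) (p : ℕ) :
    (p : ℕ∞) ≤ quotDepth (mixedIdeal K (N + 1) m hn t (k + 1)) ↔
      DepthGE (idealOfVars (Fin N) K : Set _) p
        ((Polynomial.linearExtensionColon (pathIdeal K N m)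
          (contractedColon K (N + 1) m hn) t k).comap Polynomial.C) := by
  rw [← mixedIdeal_eq_comap_C hn hk]
  refine natCast_le_gradedDepth_iff idealOfVars_ne_top ?_
  refine le_trans Ideal.mul_le_left (le_trans (Ideal.pow_le_self (by omega)) ?_)
  exact (pathIdeal_le_contractedColon hn).trans (contractedColon_le_idealOfVars hm hmn hn)

theorem quotDepth_colonIdeal_le (hm : 2 ≤ m) (hmn : m < N + 1) (hn : 0 < N + 1)
    {t k : ℕ} (hk : k + 1 ≤ t) :
    quotDepth (colonIdeal K (N + 1) m hn t k) ≤
      quotDepth (mixedIdeal K (N + 1) m hn t (k + 1)) + 1 := by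
  have hIJ := pathIdeal_le_contractedColon (K := K) (m := m) hn
  refine ENat.forall_natCast_le_iff_le.1 fun p hp => ?_
  cases p with
  | zero => simp
  | succ p =>
    rw [natCast_le_quotDepth_colonIdeal_iff hm hmn hn (by omega)] at hp
    have hL := Polynomial.isDegreeHomogeneous_linearExtensionColon hIJ t k
    have := (natCast_le_quotDepth_mixedIdeal_iff hm hmn hn hk p).2 (hp.C_image hL |>.comap_C hL)
    rw [Nat.cast_succ]
    exact add_le_add_left this 1

theorem quotDepth_mixedIdeal_eq (hm : 2 ≤ m) (hmn : m < N + 1) (hn : 0 < N + 1)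
    {t k : ℕ} (hk : k + 1 ≤ t)
    (h : quotDepth (colonIdeal K (N + 1) m hn t k) <
      quotDepth (colonIdeal K (N + 1) m hn t (k + 1))) :
    quotDepth (mixedIdeal K (N + 1) m hn t (k + 1)) =
      quotDepth (colonIdeal K (N + 1) m hn t k) := by
  have hL := Polynomial.isDegreeHomogeneous_linearExtensionColon
    (pathIdeal_le_contractedColon (K := K) (m := m) hn) t k
  have hB := natCast_le_quotDepth_colonIdeal_iff (K := K) hm hmn hn (t := t) (by omega) k
  have hA := natCast_le_quotDepth_colonIdeal_iff (K := K) hm hmn hn (t := t) (by omega) (k + 1)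
  have hC := natCast_le_quotDepth_mixedIdeal_iff (K := K) hm hmn hn hk
  simp_rw [← hL.depthGE_sup_span_X] at hC
  simp_rw [← Polynomial.linearExtensionColon_colon] at hA
  -- The strict inequality makes the middle depth a finite `p` and gives the left term depth at
  -- least `p + 1`. Depth `p + 1` on the right would then force it in the middle.
  obtain ⟨p, hp⟩ := ENat.ne_top_iff_exists.1 (ne_top_of_lt h)
  rw [← hp] at h ⊢
  have hA' := (hA (p + 1)).1 (by exact_mod_cast Order.add_one_le_of_lt h)
  apply le_antisymm
  · by_contra! hlt
    have hC' := (hC (p + 1)).1 (by exact_mod_cast Order.add_one_le_of_lt hlt)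
    have := (hB (p + 1)).2 (DepthGE.of_colon_of_sup (Ideal.avoidsPrimes _) hA' hC')
    rw [← hp] at this
    exact absurd this (by norm_cast; omega)
  · exact (hC p).2 (DepthGE.sup_of_colon (Ideal.avoidsPrimes _) hA' ((hB p).1 hp.le))

end DepthOfColonIdeals

/-! ### Gluing direct sum decompositions and Stanley decompositions -/

section Independence

theorem iSupIndep.sumElim {α ι κ : Type*} [CompleteLattice α] [IsModularLattice α]
    {f : ι → α} {g : κ → α} (hf : iSupIndep f) (hg : iSupIndep g)
    (hfg : Disjoint (⨆ i, f i) (⨆ j, g j)) : iSupIndep (Sum.elim f g) := by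
  rintro (i | j)
  · have hle : (⨆ (k) (_ : k ≠ Sum.inl i), Sum.elim f g k) ≤
        (⨆ (k) (_ : k ≠ i), f k) ⊔ ⨆ j, g j := by
      refine iSup₂_le ?_
      rintro (k | k) hk
      · exact le_sup_of_le_left (le_iSup₂_of_le k (fun h => hk (h ▸ rfl)) le_rfl)
      · exact le_sup_of_le_right (le_iSup g k)
    refine Disjoint.mono_right hle ((hf i).disjoint_sup_right_of_disjoint_sup_left ?_)
    exact hfg.mono_left (sup_le (le_iSup f i) (iSup₂_le fun k _ => le_iSup f k))
  · have hle : (⨆ (k) (_ : k ≠ Sum.inr j), Sum.elim f g k) ≤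
        (⨆ (k) (_ : k ≠ j), g k) ⊔ ⨆ i, f i := by
      refine iSup₂_le ?_
      rintro (k | k) hk
      · exact le_sup_of_le_right (le_iSup f k)
      · exact le_sup_of_le_left (le_iSup₂_of_le k (fun h => hk (h ▸ rfl)) le_rfl)
    refine Disjoint.mono_right hle ((hg j).disjoint_sup_right_of_disjoint_sup_left ?_)
    exact hfg.symm.mono_left (sup_le (le_iSup g j) (iSup₂_le fun k _ => le_iSup g k))

theorem DirectSum.IsInternal.append_map {K M₁ M₂ M : Type*} [Ring K] [AddCommGroup M₁]
    [AddCommGroup M₂] [AddCommGroup M] [Module K M₁] [Module K M₂] [Module K M] {a b : ℕ}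
    {f : Fin a → Submodule K M₁} {g : Fin b → Submodule K M₂} (hf : DirectSum.IsInternal f)
    (hg : DirectSum.IsInternal g) {α : M₁ →ₗ[K] M} {β : M₂ →ₗ[K] M}
    (hα : Function.Injective α) (hβ : Function.Injective β)
    (hcompl : IsCompl (LinearMap.range α) (LinearMap.range β)) :
    DirectSum.IsInternal
      (Fin.append (fun i => (f i).map α) (fun j => (g j).map β)) := by
  rw [DirectSum.isInternal_submodule_iff_iSupIndep_and_iSup_eq_top] at *
  have h1 : ⨆ i, (f i).map α = LinearMap.range α := by
    rw [← Submodule.map_iSup, hf.2, Submodule.map_top]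
  have h2 : ⨆ j, (g j).map β = LinearMap.range β := by
    rw [← Submodule.map_iSup, hg.2, Submodule.map_top]
  have happ : Fin.append (fun i => (f i).map α) (fun j => (g j).map β) =
      Sum.elim (fun i => (f i).map α) (fun j => (g j).map β) ∘ finSumFinEquiv.symm := by
    funext k
    refine Fin.addCases (fun i => ?_) (fun j => ?_) k <;> simp
  rw [happ]
  constructor
  · refine iSupIndep.comp (iSupIndep.sumElim (α.iSupIndep_map hα hf.1) (β.iSupIndep_map hβ hg.1) ?_)
      finSumFinEquiv.symm.injective
    rw [h1, h2]
    exact hcompl.disjoint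
  · rw [← hcompl.sup_eq_top, ← h1, ← h2]
    exact finSumFinEquiv.symm.iSup_comp.trans iSup_sum

end Independence

section StanleyDecompositions

variable {σ τ K : Type*} [Field K]

theorem mem_stanleySpace {L : Ideal (MvPolynomial σ K)} {u : σ →₀ ℕ} {Z : Finset σ}
    {z : MvPolynomial σ K ⧸ L} :
    z ∈ stanleySpace L u Z ↔ ∃ q ∈ supported K (Z : Set σ),
      Ideal.Quotient.mk L (monomial u 1 * q) = z := by
  simp [stanleySpace]

theorem supported_map (f : τ ↪ σ) (W : Finset τ) :
    supported K ((W.map f : Finset σ) : Set σ) = (supported K (W : Set τ)).map (rename f) := by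
  rw [supported, supported, AlgHom.map_adjoin, Finset.coe_map, Set.image_image, Set.image_image]
  simp

/-- Multiplication by `x_i` as a map `S / (L : x_i) → S / L`. -/
noncomputable def mulColonMap (L : Ideal (MvPolynomial σ K)) (i : σ) :
    (MvPolynomial σ K ⧸ L.colon {X i}) →ₗ[K] (MvPolynomial σ K ⧸ L) :=
  (Submodule.mapQ (L.colon {X i}) L (LinearMap.mulLeft (MvPolynomial σ K) (X i)) fun p hp => by
    rw [Submodule.mem_comap, LinearMap.mulLeft_apply, mul_comm]
    exact mem_colon_singleton'.1 hp).restrictScalars K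

theorem mulColonMap_mk (L : Ideal (MvPolynomial σ K)) (i : σ) (p : MvPolynomial σ K) :
    mulColonMap L i (Ideal.Quotient.mk _ p) = Ideal.Quotient.mk L (X i * p) := rfl

theorem mulColonMap_injective (L : Ideal (MvPolynomial σ K)) (i : σ) :
    Function.Injective (mulColonMap L i) := by
  rw [injective_iff_map_eq_zero]
  intro z hz
  obtain ⟨p, rfl⟩ := Ideal.Quotient.mk_surjective z
  rw [mulColonMap_mk, Ideal.Quotient.eq_zero_iff_mem] at hz
  rwa [Ideal.Quotient.eq_zero_iff_mem, mem_colon_singleton', mul_comm]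

theorem monomial_single_add_mul (i : σ) (u : σ →₀ ℕ) (q : MvPolynomial σ K) :
    monomial (Finsupp.single i 1 + u) (1 : K) * q = X i * (monomial u 1 * q) := by
  rw [X, ← mul_assoc, monomial_mul, one_mul]

theorem map_mulColonMap_stanleySpace (L : Ideal (MvPolynomial σ K)) (i : σ) (u : σ →₀ ℕ)
    (Z : Finset σ) : (stanleySpace (L.colon {X i}) u Z).map (mulColonMap L i) =
      stanleySpace L (Finsupp.single i 1 + u) Z := by
  ext z
  simp only [Submodule.mem_map, mem_stanleySpace, monomial_single_add_mul, ← mulColonMap_mk]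
  constructor
  · rintro ⟨_, ⟨q, hq, rfl⟩, rfl⟩
    exact ⟨q, hq, rfl⟩
  · rintro ⟨q, hq, rfl⟩
    exact ⟨_, ⟨q, hq, rfl⟩, rfl⟩

/-- The inclusion `S' / (L ∩ S') → S / L`. -/
noncomputable def comapRenameMap (L : Ideal (MvPolynomial σ K)) (f : τ → σ) :
    (MvPolynomial τ K ⧸ L.comap (rename f : MvPolynomial τ K →ₐ[K] MvPolynomial σ K)) →ₗ[K]
      (MvPolynomial σ K ⧸ L) :=
  (Ideal.quotientMapₐ L (rename f) le_rfl).toLinearMap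

theorem comapRenameMap_mk (L : Ideal (MvPolynomial σ K)) (f : τ → σ) (p : MvPolynomial τ K) :
    comapRenameMap L f (Ideal.Quotient.mk _ p) = Ideal.Quotient.mk L (rename f p) := rfl

theorem comapRenameMap_injective (L : Ideal (MvPolynomial σ K)) (f : τ → σ) :
    Function.Injective (comapRenameMap L f) := by
  rw [injective_iff_map_eq_zero]
  intro z hz
  obtain ⟨p, rfl⟩ := Ideal.Quotient.mk_surjective z
  rw [comapRenameMap_mk, Ideal.Quotient.eq_zero_iff_mem] at hz
  rwa [Ideal.Quotient.eq_zero_iff_mem, Ideal.mem_comap]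

theorem map_comapRenameMap_stanleySpace (L : Ideal (MvPolynomial σ K)) (f : τ ↪ σ) (v : τ →₀ ℕ)
    (W : Finset τ) :
    (stanleySpace (L.comap (rename f : MvPolynomial τ K →ₐ[K] _)) v W).map (comapRenameMap L f) =
      stanleySpace L (v.mapDomain f) (W.map f) := by
  ext z
  simp only [Submodule.mem_map, mem_stanleySpace, supported_map, Subalgebra.mem_map]
  constructor
  · rintro ⟨_, ⟨q, hq, rfl⟩, rfl⟩
    exact ⟨_, ⟨q, hq, rfl⟩, by rw [comapRenameMap_mk, map_mul (rename f), rename_monomial]⟩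
  · rintro ⟨_, ⟨q, hq, rfl⟩, rfl⟩
    exact ⟨_, ⟨q, hq, rfl⟩, by rw [comapRenameMap_mk, map_mul (rename f), rename_monomial]⟩

/-- The complement to the multiples of `x_i` consists of the parts free of `x_i`; `hL` says that `L`
contains the `x_i`-free part of each of its elements, so the two meet only in zero. -/
theorem isCompl_range_mulColonMap_comapRenameMap {L : Ideal (MvPolynomial σ K)} {i : σ}
    {f : τ → σ} (hdecomp : ∀ p : MvPolynomial σ K, ∃ a s, p = rename f a + X i * s)
    (hL : ∀ a s, rename f a + X i * s ∈ L → rename f a ∈ L) :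
    IsCompl (LinearMap.range (mulColonMap L i)) (LinearMap.range (comapRenameMap L f)) := by
  constructor
  · rw [Submodule.disjoint_def]
    rintro _ ⟨s, rfl⟩ ⟨a, ha⟩
    obtain ⟨s, rfl⟩ := Ideal.Quotient.mk_surjective s
    obtain ⟨a, rfl⟩ := Ideal.Quotient.mk_surjective a
    rw [← ha, comapRenameMap_mk, Ideal.Quotient.eq_zero_iff_mem]
    rw [comapRenameMap_mk, mulColonMap_mk, Ideal.Quotient.eq] at ha
    exact hL a (-s) (by simpa [sub_eq_add_neg] using ha)
  · rw [codisjoint_iff, eq_top_iff]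
    rintro z -
    obtain ⟨p, rfl⟩ := Ideal.Quotient.mk_surjective z
    obtain ⟨a, s, rfl⟩ := hdecomp p
    rw [map_add, add_comm, ← mulColonMap_mk, ← comapRenameMap_mk]
    exact Submodule.add_mem_sup ⟨_, rfl⟩ ⟨_, rfl⟩

/-- Stanley decompositions of `S / (L : x_i)` and of `S' / (L ∩ S')` combine to a Stanley
decomposition of `S / L`. -/
noncomputable def StanleyDecomposition.glue {L : Ideal (MvPolynomial σ K)} {i : σ} {f : τ ↪ σ}
    (hdecomp : ∀ p : MvPolynomial σ K, ∃ a s, p = rename f a + X i * s)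
    (hL : ∀ a s, rename f a + X i * s ∈ L → rename f a ∈ L)
    (D : StanleyDecomposition (L.colon {X i}))
    (E : StanleyDecomposition (L.comap (rename f : MvPolynomial τ K →ₐ[K] MvPolynomial σ K))) :
    StanleyDecomposition L where
  r := D.r + E.r
  u := Fin.append (fun j => Finsupp.single i 1 + D.u j) (fun j => (E.u j).mapDomain f)
  Z := Fin.append D.Z (fun j => (E.Z j).map f)
  free := by
    intro k
    refine Fin.addCases (fun j => ?_) (fun j => ?_) k
    · simp only [Fin.append_left]
      intro q hq h
      refine D.free j q hq (mem_colon_singleton'.2 ?_)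
      rwa [monomial_single_add_mul, mul_comm] at h
    · simp only [Fin.append_right, supported_map]
      rintro _ ⟨q, hq, rfl⟩ h
      rw [E.free j q hq, map_zero]
      rw [Ideal.mem_comap, map_mul, rename_monomial]
      exact h
  isInternal := by
    have hspace : (fun k => stanleySpace L
        ((Fin.append (fun j => Finsupp.single i 1 + D.u j) fun j => (E.u j).mapDomain f :
          Fin (D.r + E.r) → σ →₀ ℕ) k)
        ((Fin.append D.Z fun j => (E.Z j).map f : Fin (D.r + E.r) → Finset σ) k)) =
        Fin.append (fun j => (stanleySpace _ (D.u j) (D.Z j)).map (mulColonMap L i))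
          (fun j => (stanleySpace _ (E.u j) (E.Z j)).map (comapRenameMap L f)) := by
      funext k
      refine Fin.addCases (fun j => ?_) (fun j => ?_) k
      · simp only [Fin.append_left, map_mulColonMap_stanleySpace]
      · simp only [Fin.append_right, map_comapRenameMap_stanleySpace]
    rw [hspace]
    exact D.isInternal.append_map E.isInternal (mulColonMap_injective L i)
      (comapRenameMap_injective L f) (isCompl_range_mulColonMap_comapRenameMap hdecomp hL)

theorem min_quotSdepth_le {L : Ideal (MvPolynomial σ K)} {i : σ} {f : τ ↪ σ}
    (hdecomp : ∀ p : MvPolynomial σ K, ∃ a s, p = rename f a + X i * s)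
    (hL : ∀ a s, rename f a + X i * s ∈ L → rename f a ∈ L) :
    min (quotSdepth (L.colon {X i}))
      (quotSdepth (L.comap (rename f : MvPolynomial τ K →ₐ[K] MvPolynomial σ K))) ≤
      quotSdepth L := by
  -- Testing against `c` below the minimum avoids having to know that the suprema are attained.
  refine le_of_forall_lt fun c hc => ?_
  obtain ⟨hA, hC⟩ := lt_min_iff.1 hc
  obtain ⟨D, hD⟩ := lt_iSup_iff.1 hA
  obtain ⟨E, hE⟩ := lt_iSup_iff.1 hC
  refine lt_of_lt_of_le (lt_min hD hE) (le_iSup_of_le (D.glue hdecomp hL E) (le_iInf ?_))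
  intro k
  refine Fin.addCases (fun j => ?_) (fun j => ?_) k
  · simp only [StanleyDecomposition.glue, Fin.append_left]
    exact min_le_of_left_le (iInf_le _ j)
  · simp only [StanleyDecomposition.glue, Fin.append_right, Finset.card_map]
    exact min_le_of_right_le (iInf_le _ j)

end StanleyDecompositions

/-! ### The Stanley depth claim -/

section StanleyDepthOfColonIdeals

variable {K : Type*} [Field K] {N m : ℕ}

theorem comap_initialInclusion_colonIdeal (hmn : m < N + 1) (hn : 0 < N + 1) (t k : ℕ) :
    (colonIdeal K (N + 1) m hn t k).comap (initialInclusion K N) =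
      (Polynomial.linearExtensionColon (pathIdeal K N m) (contractedColon K (N + 1) m hn) t k).comap
        Polynomial.C := by
  ext p
  rw [Ideal.mem_comap, Ideal.mem_comap, ← map_lastVarEquiv_colonIdeal hmn hn,
    ← lastVarEquiv_initialInclusion, lastVarEquiv_mem_map_iff]

theorem exists_eq_initialInclusion_add (p : MvPolynomial (Fin (N + 1)) K) :
    ∃ a s, p = initialInclusion K N a + X (Fin.last N) * s := by
  refine ⟨(lastVarEquiv K N p).coeff 0, (lastVarEquiv K N).symm (lastVarEquiv K N p).divX, ?_⟩
  apply (lastVarEquiv K N).injective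
  rw [map_add, map_mul, lastVarEquiv_initialInclusion, lastVarEquiv_X_last,
    AlgEquiv.apply_symm_apply]
  exact (Polynomial.X_mul_divX_add _).symm.trans (add_comm _ _)

theorem initialInclusion_mem_colonIdeal (hmn : m < N + 1) (hn : 0 < N + 1) {t k : ℕ}
    {a : MvPolynomial (Fin N) K} {s : MvPolynomial (Fin (N + 1)) K}
    (h : initialInclusion K N a + X (Fin.last N) * s ∈ colonIdeal K (N + 1) m hn t k) :
    initialInclusion K N a ∈ colonIdeal K (N + 1) m hn t k := by
  have hL := Polynomial.isDegreeHomogeneous_linearExtensionColon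
    (pathIdeal_le_contractedColon (K := K) (m := m) hn) t k
  have h' := Ideal.mem_map_of_mem (lastVarEquiv K N) h
  rw [map_lastVarEquiv_colonIdeal hmn hn, map_add, map_mul, lastVarEquiv_initialInclusion,
    lastVarEquiv_X_last] at h'
  have := hL _ h' 0
  rw [← Ideal.mem_comap, comap_initialInclusion_colonIdeal hmn hn, Ideal.mem_comap]
  simpa using this

theorem quotSdepth_mixedIdeal_le (hmn : m < N + 1) (hn : 0 < N + 1) {t k : ℕ} (hk : k + 1 ≤ t)
    (h : quotSdepth (colonIdeal K (N + 1) m hn t k) <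
      quotSdepth (colonIdeal K (N + 1) m hn t (k + 1))) :
    quotSdepth (mixedIdeal K (N + 1) m hn t (k + 1)) ≤
      quotSdepth (colonIdeal K (N + 1) m hn t k) := by
  have hcolon : (colonIdeal K (N + 1) m hn t k).colon {X (Fin.last N)} =
      colonIdeal K (N + 1) m hn t (k + 1) := by
    ext p
    simp only [colonIdeal, mem_colon_singleton', lastVar_succ, mul_assoc, pow_succ']
  have hmin := min_quotSdepth_le (L := colonIdeal K (N + 1) m hn t k) (i := Fin.last N)
    (f := Fin.castLEEmb (Nat.sub_le (N + 1) 1)) exists_eq_initialInclusion_add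
    (fun a s => initialInclusion_mem_colonIdeal hmn hn)
  rw [hcolon] at hmin
  have hmixed := (comap_initialInclusion_colonIdeal (K := K) hmn hn t k).trans
    (mixedIdeal_eq_comap_C hn hk).symm
  have hmin' : min (quotSdepth (colonIdeal K (N + 1) m hn t (k + 1)))
      (quotSdepth ((colonIdeal K (N + 1) m hn t k).comap (initialInclusion K N))) ≤
      quotSdepth (colonIdeal K (N + 1) m hn t k) := hmin
  rw [hmixed] at hmin'
  exact (min_le_iff.1 hmin').resolve_left (not_le_of_gt h)

end StanleyDepthOfColonIdeals

theorem proposition3p2 (K : Type*) [Field K] (n m : ℕ) (hm : 2 ≤ m) (hmn : m < n) (hn : 0 < n)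
    (t k : ℕ) (hk : 1 ≤ k) (hkt : k ≤ t) :
    quotDepth (colonIdeal K n m hn t (k - 1)) ≤ quotDepth (mixedIdeal K n m hn t k) + 1 ∧
    (quotDepth (colonIdeal K n m hn t (k - 1)) < quotDepth (colonIdeal K n m hn t k) →
      quotDepth (mixedIdeal K n m hn t k) = quotDepth (colonIdeal K n m hn t (k - 1))) ∧
    (quotSdepth (colonIdeal K n m hn t (k - 1)) < quotSdepth (colonIdeal K n m hn t k) →
      quotSdepth (mixedIdeal K n m hn t k) ≤ quotSdepth (colonIdeal K n m hn t (k - 1))) := by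
  obtain ⟨N, rfl⟩ := Nat.exists_eq_add_of_le' hn
  -- After this shift the mixed ideal of index `k + 1` is the degree-zero part of the colon ideal
  -- with exponent `k`.
  obtain ⟨k, rfl⟩ := Nat.exists_eq_add_of_le' hk
  exact ⟨quotDepth_colonIdeal_le hm hmn hn hkt, quotDepth_mixedIdeal_eq hm hmn hn hkt,
    quotSdepth_mixedIdeal_le hmn hn hkt⟩
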